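/- Fix $T>0$ and $\rho\in[0,1]$, put $\chi(\rho)=\rho(1-\rho)$, and for $\alpha>0$, $t>0$ let $$F_\alpha(t)=\frac1{2t}\int_0^{\infty} z\,e^{-z^2/(4t)-2\alpha z}\,dz .$$ For each $\alpha\in(0,\infty)$ let $\{\Gamma_\alpha(t):t\in[0,T]\}$ be the process that arises as the limit of the rescaled occupation time of the origin in the symmetric exclusion process with a slow bond of conductance $\alpha/n$ (the case $\beta=1$), that is, a mean-zero Gaussian process with stationary increments and variance $$\mathbb E\big[\Gamma_\alpha(t)^2\big]=\frac43\frac{\chi(\rho)}{\sqrt\pi}\,t^{3/2}+2\chi(\rho)\int_0^t\!\int_0^s\frac{F_\alpha(s-r)}{\sqrt{4\pi(s-r)}}\,dr\,ds .$$ Let $\{\Gamma_\infty(t):t\in[0,T]\}$ and $\{\Gamma_0(t):t\in[0,T]\}$ be mean-zero Gaussian processes with stationary increments and variances $$\mathbb E\big[\Gamma_\infty(t)^2\big]=\frac43\frac{\chi(\rho)}{\sqrt\pi}\,t^{3/2},\qquad \mathbb E\big[\Gamma_0(t)^2\big]=\frac83\frac{\chi(\rho)}{\sqrt\pi}\,t^{3/2}.$$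 Then $\Gamma_\infty$ and $\Gamma_0$ are, in law, fractional Brownian motions of Hurst exponent $3/4$ (that is, mean-zero Gaussian with covariance $\frac c2\big(s^{3/2}+t^{3/2}-|t-s|^{3/2}\big)$, where $c=\frac43\frac{\chi(\rho)}{\sqrt\pi}$ for $\Gamma_\infty$ and twice this value for $\Gamma_0$). In the sense of finite-dimensional distributions, $\Gamma_\alpha$ converges to $\Gamma_\infty$ as $\alpha\to\infty$, and $\Gamma_\alpha$ converges to $\Gamma_0$ as $\alpha\to0$. -/

import Mathlib

open Real Set Filter Topology MeasureTheory ProbabilityTheory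

noncomputable section

namespace OccupationTime

/-- The static compressibility `χ(ρ) = ρ (1 - ρ)`. -/
def chi (ρ : ℝ) : ℝ := ρ * (1 - ρ)

/-- `F_α(t) = (1 / 2t) ∫₀^∞ z exp(-z² / 4t - 2 α z) dz`, for `t > 0`. -/
def robinF (α t : ℝ) : ℝ :=
  1 / (2 * t) * ∫ z in Ioi (0 : ℝ), z * Real.exp (-z ^ 2 / (4 * t) - 2 * α * z)

/-- The variance function of `Γ_∞` (regime `β < 1`): `(4/3) (χ(ρ) / √π) t^{3/2}`. -/
def varInfty (ρ t : ℝ) : ℝ := 4 / 3 * (chi ρ / √π) * t ^ (3 / 2 : ℝ)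

/-- The variance function of `Γ_α` (regime `β = 1`):
`(4/3) (χ(ρ) / √π) t^{3/2} + 2 χ(ρ) ∫₀ᵗ ∫₀ˢ F_α(s - r) / √(4 π (s - r)) dr ds`. -/
def varRobin (ρ α t : ℝ) : ℝ :=
  4 / 3 * (chi ρ / √π) * t ^ (3 / 2 : ℝ) +
    2 * chi ρ * ∫ s in (0 : ℝ)..t, ∫ r in (0 : ℝ)..s, robinF α (s - r) / √(4 * π * (s - r))

/-- The variance function of `Γ_0` (regime `β > 1`): `(8/3) (χ(ρ) / √π) t^{3/2}`. -/
def varZero (ρ t : ℝ) : ℝ := 8 / 3 * (chi ρ / √π) * t ^ (3 / 2 : ℝ)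

/-- The process `X`, indexed by `[0, T]`, is a mean-zero Gaussian process with stationary
increments and with variance function `E[X(t)²] = v(t)`.
If `v 0 = 0` then `X(0) = 0` almost surely, and these properties determine the law of `X`. -/
structure IsStationaryGaussian {Ω : Type*} [MeasurableSpace Ω] {T : ℝ}
    (X : Icc (0 : ℝ) T → Ω → ℝ) (P : Measure Ω) (v : ℝ → ℝ) : Prop where
  isGaussian : IsGaussianProcess X P
  mean_zero : ∀ t, ∫ ω, X t ω ∂P = 0
  stationary_increments : ∀ s t s' t' : Icc (0 : ℝ) T, (t : ℝ) - s = (t' : ℝ) - s' →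
    IdentDistrib (fun ω ↦ X t ω - X s ω) (fun ω ↦ X t' ω - X s' ω) P P
  variance_eq : ∀ t : Icc (0 : ℝ) T, ∫ ω, X t ω ^ 2 ∂P = v t

/-- The process `X`, indexed by `[0, T]`, is (in law) a fractional Brownian motion of Hurst
exponent `H` with variance `c t^{2H}`: it is mean-zero Gaussian with covariance
`(c / 2) (s^{2H} + t^{2H} - |t - s|^{2H})`. -/
structure IsFractionalBrownianMotion {Ω : Type*} [MeasurableSpace Ω] {T : ℝ}
    (H c : ℝ) (X : Icc (0 : ℝ) T → Ω → ℝ) (P : Measure Ω) : Prop where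
  isGaussian : IsGaussianProcess X P
  mean_zero : ∀ t, ∫ ω, X t ω ∂P = 0
  covariance_eq : ∀ s t : Icc (0 : ℝ) T, ∫ ω, X s ω * X t ω ∂P =
    c / 2 * ((s : ℝ) ^ (2 * H) + (t : ℝ) ^ (2 * H) - |(t : ℝ) - s| ^ (2 * H))

/-- Convergence in the sense of finite-dimensional distributions, along the filter `l`: for all
times `t₁, …, t_k`, the vector `(X_i(t₁), …, X_i(t_k))` converges in distribution to
`(Y(t₁), …, Y(t_k))`. -/
def ConvergesFDD {ι τ : Type*} {Ω : ι → Type*} [∀ i, MeasurableSpace (Ω i)]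
    {Ω' : Type*} [MeasurableSpace Ω']
    (X : (i : ι) → τ → Ω i → ℝ) (P : (i : ι) → Measure (Ω i)) [∀ i, IsProbabilityMeasure (P i)]
    (l : Filter ι) (Y : τ → Ω' → ℝ) (P' : Measure Ω') [IsProbabilityMeasure P'] : Prop :=
  ∀ (k : ℕ) (t : Fin k → τ),
    TendstoInDistribution (fun i ω (j : Fin k) ↦ X i (t j) ω) l (fun ω (j : Fin k) ↦ Y (t j) ω)
      P P'

end OccupationTime

end

/-!
The law of a mean-zero Gaussian process is determined by its covariance, and for a process with
stationary increments which starts at `0` the covariance is read off from the variance function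
`v` by polarization: `E[X(s) X(t)] = (v(s) + v(t) - v(|t - s|)) / 2`. This gives at once that
`Γ_∞` and `Γ_0`, whose variance functions are multiples of `t ^ (3 / 2)`, are fractional Brownian
motions. It also reduces convergence of finite-dimensional distributions to pointwise convergence
of variance functions (`IsStationaryGaussian.convergesFDD`): the characteristic function of
`(X(t₁), …, X(t_k))` at `a` is `exp (-Var[∑ aⱼ X(tⱼ)] / 2)`, a continuous function of the
covariances, and Lévy's continuity theorem applies.

Convergence of the variances rests on the bound `0 ≤ F_α ≤ 1` for `α ≥ 0`, where `F_0 = 1` is a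
Gaussian moment, and on `F_α(u) → 0` as `α → ∞` and `F_α(u) → 1` as `α → 0` for each `u > 0`
(`tendsto_robinF_atTop`, `tendsto_robinF_zero`). Since `1 / √(4 π u)` is integrable at `0`,
dominated convergence in both integrals shows that the correction to the variance tends to `c`
times `2 χ(ρ) ∫₀ᵗ ∫₀ˢ (4 π (s - r))^(-1/2) dr ds = (4/3) (χ(ρ) / √π) t ^ (3 / 2)`, where `c = 0`
as `α → ∞` and `c = 1` as `α → 0` (`tendsto_iterated_integral_div_sqrt`).
-/

noncomputable section

namespace OccupationTime

/-! ### Covariance of a Gaussian process with stationary increments -/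

section Gaussian

variable {Ω : Type*} [MeasurableSpace Ω] {P : Measure Ω} {T : ℝ}
  {X : Icc (0 : ℝ) T → Ω → ℝ} {v : ℝ → ℝ}

lemma IsStationaryGaussian.memLp_two (hX : IsStationaryGaussian X P v) (t : Icc (0 : ℝ) T) :
    MemLp (X t) 2 P :=
  (hX.isGaussian.hasGaussianLaw_eval t).memLp_two

lemma IsStationaryGaussian.integral_sub_sq_of_le (hX : IsStationaryGaussian X P v)
    (hv : v 0 = 0) {s t : Icc (0 : ℝ) T} (hst : s ≤ t) :
    ∫ ω, (X t ω - X s ω) ^ 2 ∂P = v ((t : ℝ) - s) := by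
  have hst' : (s : ℝ) ≤ t := hst
  let o : Icc (0 : ℝ) T := ⟨0, le_rfl, t.2.1.trans t.2.2⟩
  let d : Icc (0 : ℝ) T := ⟨(t : ℝ) - s, sub_nonneg.2 hst', by linarith [s.2.1, t.2.2]⟩
  have h0 : X o =ᵐ[P] 0 := by
    have h : ∫ ω, X o ω ^ 2 ∂P = 0 := by rw [hX.variance_eq o]; exact hv
    rw [integral_eq_zero_iff_of_nonneg (fun ω ↦ sq_nonneg _)
      (hX.memLp_two o).integrable_sq] at h
    filter_upwards [h] with ω hω
    simpa using hω
  have hid := hX.stationary_increments s t o d (by simp [o, d])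
  have hsq := (hid.comp (measurable_id.pow_const 2)).integral_eq
  simp only [Function.comp_def, id_eq] at hsq
  rw [hsq, ← hX.variance_eq d]
  refine integral_congr_ae ?_
  filter_upwards [h0] with ω hω
  simp [hω]

/-- Polarization: the covariance of a centred process with stationary increments is determined by
its variance function. -/
lemma IsStationaryGaussian.integral_mul (hX : IsStationaryGaussian X P v) (hv : v 0 = 0)
    (s t : Icc (0 : ℝ) T) :
    ∫ ω, X s ω * X t ω ∂P = (v s + v t - v |(t : ℝ) - s|) / 2 := by
  have hinc : ∫ ω, (X t ω - X s ω) ^ 2 ∂P = v |(t : ℝ) - s| := by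
    rcases le_total s t with h | h
    · rw [hX.integral_sub_sq_of_le hv h, abs_of_nonneg (sub_nonneg.2 (Subtype.coe_le_coe.2 h))]
    · rw [abs_sub_comm, abs_of_nonneg (sub_nonneg.2 (Subtype.coe_le_coe.2 h)),
        ← hX.integral_sub_sq_of_le hv h]
      exact integral_congr_ae (.of_forall fun ω ↦ by simp only; ring)
  have hexp : ∀ ω, (X t ω - X s ω) ^ 2 = X t ω ^ 2 + X s ω ^ 2 - 2 * (X s ω * X t ω) :=
    fun ω ↦ by ring
  have hst : Integrable (fun ω ↦ X s ω * X t ω) P :=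
    (hX.memLp_two s).integrable_mul (hX.memLp_two t)
  simp_rw [hexp] at hinc
  have hadd : Integrable (fun ω ↦ X t ω ^ 2 + X s ω ^ 2) P :=
    (hX.memLp_two t).integrable_sq.add (hX.memLp_two s).integrable_sq
  rw [integral_sub hadd (hst.const_mul 2),
    integral_add (hX.memLp_two t).integrable_sq (hX.memLp_two s).integrable_sq,
    integral_const_mul, hX.variance_eq, hX.variance_eq] at hinc
  linarith

lemma IsStationaryGaussian.isFractionalBrownianMotion {H c : ℝ} (hH : H ≠ 0)
    (hX : IsStationaryGaussian X P fun t ↦ c * t ^ (2 * H)) :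
    IsFractionalBrownianMotion H c X P where
  isGaussian := hX.isGaussian
  mean_zero := hX.mean_zero
  covariance_eq s t := by
    rw [hX.integral_mul (by simp [Real.zero_rpow, hH])]
    ring

/-! ### Finite-dimensional distributions -/

/-- The vector `(X(t₁), …, X(t_k))`, in the Euclidean space on which characteristic functions
are defined. -/
def fddVector {Ω τ : Type*} (X : τ → Ω → ℝ) {k : ℕ} (t : Fin k → τ) (ω : Ω) :
    EuclideanSpace ℝ (Fin k) :=
  WithLp.toLp 2 fun j ↦ X (t j) ω

/-- The times `t₁, …, t_k` may repeat, so the vector is a linear image of the restriction of the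
process to the finite set of times. -/
lemma hasGaussianLaw_fddVector {τ : Type*} {Y : τ → Ω → ℝ} (hY : IsGaussianProcess Y P) {k : ℕ}
    (t : Fin k → τ) : HasGaussianLaw (fddVector Y t) P := by
  classical
  let L : (Finset.univ.image t → ℝ) →L[ℝ] (Fin k → ℝ) :=
    ContinuousLinearMap.pi fun j ↦ ContinuousLinearMap.proj ⟨t j, by simp⟩
  exact (hY.hasGaussianLaw _).map
    (((EuclideanSpace.equiv (Fin k) ℝ).symm : (Fin k → ℝ) →L[ℝ] EuclideanSpace ℝ (Fin k)).comp L)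

lemma IsStationaryGaussian.charFun_fddVector (hX : IsStationaryGaussian X P v) (hv : v 0 = 0)
    {k : ℕ} (t : Fin k → Icc (0 : ℝ) T) (a : EuclideanSpace ℝ (Fin k)) :
    charFun (P.map (fddVector X t)) a =
      Complex.exp (-((∑ i, ∑ j, a i * a j *
        ((v (t i) + v (t j) - v |(t j : ℝ) - t i|) / 2) : ℝ) : ℂ) / 2) := by
  have hinner : ∀ ω, inner ℝ a (fddVector X t ω) = ∑ j, a j * X (t j) ω := fun ω ↦ by
    simp [PiLp.inner_apply, fddVector, mul_comm]
  have hint : ∀ j, Integrable (fun ω ↦ a j * X (t j) ω) P := fun j ↦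
    (hX.isGaussian.hasGaussianLaw_eval (t j)).integrable.const_mul _
  have hmean : ∫ ω, ∑ j, a j * X (t j) ω ∂P = 0 := by
    rw [integral_finsetSum _ fun j _ ↦ hint j]
    simp [integral_const_mul, hX.mean_zero]
  have hvar : Var[fun ω ↦ ∑ j, a j * X (t j) ω; P] =
      ∑ i, ∑ j, a i * a j * ((v (t i) + v (t j) - v |(t j : ℝ) - t i|) / 2) := by
    have hpair : ∀ i j, Integrable (fun ω ↦ (a i * X (t i) ω) * (a j * X (t j) ω)) P :=
      fun i j ↦ ((hX.memLp_two (t i)).const_mul _).integrable_mul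
        ((hX.memLp_two (t j)).const_mul _)
    rw [variance_of_integral_eq_zero (integrable_finsetSum _ fun j _ ↦ hint j).aemeasurable hmean]
    simp_rw [sq, Finset.sum_mul_sum]
    rw [integral_finsetSum _ fun i _ ↦ integrable_finsetSum _ fun j _ ↦ hpair i j]
    refine Finset.sum_congr rfl fun i _ ↦ ?_
    rw [integral_finsetSum _ fun j _ ↦ hpair i j]
    refine Finset.sum_congr rfl fun j _ ↦ ?_
    rw [← hX.integral_mul hv, ← integral_const_mul]
    exact integral_congr_ae (.of_forall fun ω ↦ by simp only; ring)
  rw [(hasGaussianLaw_fddVector hX.isGaussian t).charFun_map_eq]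
  simp only [hinner]
  rw [hmean, hvar]
  congr 1
  push_cast
  ring

end Gaussian

/-- For centred Gaussian processes with stationary increments, pointwise convergence of the
variance functions implies convergence of the finite-dimensional distributions. -/
theorem IsStationaryGaussian.convergesFDD {ι : Type*} {l : Filter ι} [l.IsCountablyGenerated]
    {T : ℝ} {Ω : ι → Type*} [∀ i, MeasurableSpace (Ω i)]
    {P : (i : ι) → Measure (Ω i)} [∀ i, IsProbabilityMeasure (P i)]
    {Ω' : Type*} [MeasurableSpace Ω'] {P' : Measure Ω'} [IsProbabilityMeasure P']
    {X : (i : ι) → Icc (0 : ℝ) T → Ω i → ℝ} {Y : Icc (0 : ℝ) T → Ω' → ℝ}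
    {v : ι → ℝ → ℝ} {w : ℝ → ℝ}
    (hX : ∀ i, IsStationaryGaussian (X i) (P i) (v i)) (hY : IsStationaryGaussian Y P' w)
    (hv : ∀ i, v i 0 = 0) (hw : w 0 = 0)
    (hvw : ∀ t, 0 ≤ t → Tendsto (fun i ↦ v i t) l (𝓝 (w t))) :
    ConvergesFDD X P l Y P' := by
  intro k t
  have hE : TendstoInDistribution (fun i ↦ fddVector (X i) t) l (fddVector Y t) P P' := by
    refine ⟨fun i ↦ (hasGaussianLaw_fddVector (hX i).isGaussian t).aemeasurable,
      (hasGaussianLaw_fddVector hY.isGaussian t).aemeasurable, ?_⟩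
    -- Lévy's continuity theorem is about sequences
    refine tendsto_of_seq_tendsto fun x hx ↦ ProbabilityMeasure.tendsto_of_tendsto_charFun
      fun a ↦ ?_
    change Tendsto (fun n ↦ charFun ((P (x n)).map (fddVector (X (x n)) t)) a) atTop
      (𝓝 (charFun (P'.map (fddVector Y t)) a))
    simp_rw [(hX _).charFun_fddVector (hv _), hY.charFun_fddVector hw]
    refine (Complex.continuous_exp.tendsto _).comp
      (((Complex.continuous_ofReal.tendsto _).comp ?_).neg.div_const 2)
    refine tendsto_finsetSum _ fun i _ ↦ tendsto_finsetSum _ fun j _ ↦ ?_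
    refine Tendsto.const_mul _ (Tendsto.div_const ?_ 2)
    exact (((hvw _ (t i).2.1).add (hvw _ (t j).2.1)).sub (hvw _ (abs_nonneg _))).comp hx
  exact hE.continuous_comp (EuclideanSpace.equiv (Fin k) ℝ).continuous

/-! ### The function `F_α` -/

lemma integrableOn_mul_exp_neg_sq_div {u : ℝ} (hu : 0 < u) :
    IntegrableOn (fun z : ℝ ↦ z * Real.exp (-z ^ 2 / (4 * u))) (Ioi 0) := by
  refine (integrableOn_rpow_mul_exp_neg_mul_sq (b := 1 / (4 * u)) (by positivity)
    (s := 1) (by norm_num)).congr_fun (fun z _ ↦ ?_) measurableSet_Ioi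
  simp only [Real.rpow_one]
  congr 2
  ring

lemma integral_mul_exp_neg_sq_div {u : ℝ} (hu : 0 < u) :
    ∫ z in Ioi (0 : ℝ), z * Real.exp (-z ^ 2 / (4 * u)) = 2 * u := by
  have h := integral_rpow_mul_exp_neg_mul_rpow (p := 2) (q := 1) (b := 1 / (4 * u))
    (by norm_num) (by norm_num) (by positivity)
  have h2 : -((1 : ℝ) + 1) / 2 = -1 := by norm_num
  have h3 : ((1 : ℝ) + 1) / 2 = 1 := by norm_num
  rw [h2, h3, Real.Gamma_one, Real.rpow_neg_one] at h
  calc _ = ∫ z in Ioi (0 : ℝ), z ^ (1 : ℝ) * Real.exp (-(1 / (4 * u)) * z ^ (2 : ℝ)) := by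
        refine setIntegral_congr_fun measurableSet_Ioi fun z _ ↦ ?_
        simp only [Real.rpow_one, Real.rpow_two]
        congr 2
        ring
    _ = 2 * u := by rw [h]; field_simp; norm_num

lemma norm_integrand_robinF_le {α z u : ℝ} (hα : 0 ≤ α) (hz : 0 < z) :
    ‖z * Real.exp (-z ^ 2 / (4 * u) - 2 * α * z)‖ ≤ z * Real.exp (-z ^ 2 / (4 * u)) := by
  rw [Real.norm_of_nonneg (by positivity)]
  gcongr
  have : 0 ≤ 2 * α * z := by positivity
  linarith

lemma abs_robinF_le_one {α u : ℝ} (hα : 0 ≤ α) (hu : 0 < u) : |robinF α u| ≤ 1 := by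
  have h : ‖∫ z in Ioi (0 : ℝ), z * Real.exp (-z ^ 2 / (4 * u) - 2 * α * z)‖ ≤ 2 * u := by
    rw [← integral_mul_exp_neg_sq_div hu]
    refine norm_integral_le_of_norm_le (integrableOn_mul_exp_neg_sq_div hu) ?_
    exact (ae_restrict_iff' measurableSet_Ioi).2
      (.of_forall fun z hz ↦ norm_integrand_robinF_le hα hz)
  rw [robinF, abs_mul, abs_of_pos (by positivity), one_div, inv_mul_le_iff₀ (by positivity),
    mul_one]
  exact h

lemma measurable_robinF (α : ℝ) : Measurable (robinF α) := by
  unfold robinF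
  refine Measurable.mul (by fun_prop) (StronglyMeasurable.measurable ?_)
  refine StronglyMeasurable.integral_prod_right
    (f := fun t z : ℝ ↦ z * Real.exp (-z ^ 2 / (4 * t) - 2 * α * z)) ?_
  refine Measurable.stronglyMeasurable ?_
  unfold Function.uncurry
  fun_prop

lemma tendsto_robinF {ι : Type*} {l : Filter ι} [l.IsCountablyGenerated] {α : ι → ℝ}
    (hα : ∀ i, 0 ≤ α i) {c u : ℝ} (hu : 0 < u)
    (h : ∀ z, 0 < z → Tendsto (fun i ↦ Real.exp (-(2 * α i * z))) l (𝓝 c)) :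
    Tendsto (fun i ↦ robinF (α i) u) l (𝓝 c) := by
  have hlim : Tendsto
      (fun i ↦ ∫ z in Ioi (0 : ℝ), z * Real.exp (-z ^ 2 / (4 * u) - 2 * α i * z)) l
      (𝓝 (∫ z in Ioi (0 : ℝ), z * Real.exp (-z ^ 2 / (4 * u)) * c)) := by
    refine tendsto_integral_filter_of_dominated_convergence
      (fun z ↦ z * Real.exp (-z ^ 2 / (4 * u))) ?_ ?_ (integrableOn_mul_exp_neg_sq_div hu) ?_
    · exact .of_forall fun i ↦ Continuous.aestronglyMeasurable (by fun_prop)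
    · exact .of_forall fun i ↦ (ae_restrict_iff' measurableSet_Ioi).2
        (.of_forall fun z hz ↦ norm_integrand_robinF_le (hα i) hz)
    · refine (ae_restrict_iff' measurableSet_Ioi).2 (.of_forall fun z hz ↦ ?_)
      simp_rw [sub_eq_add_neg, Real.exp_add, ← mul_assoc z]
      exact (h z hz).const_mul _
  rw [integral_mul_const, integral_mul_exp_neg_sq_div hu] at hlim
  have := hlim.const_mul (1 / (2 * u))
  have hc : 1 / (2 * u) * (2 * u * c) = c := by field_simp
  rw [hc] at this
  exact this

lemma tendsto_robinF_atTop {u : ℝ} (hu : 0 < u) :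
    Tendsto (fun α : Ioi (0 : ℝ) ↦ robinF α u) (comap ((↑) : Ioi (0 : ℝ) → ℝ) atTop) (𝓝 0) := by
  refine tendsto_robinF (fun α ↦ α.2.le) hu fun z hz ↦ ?_
  refine Real.tendsto_exp_neg_atTop_nhds_zero.comp ?_
  exact (tendsto_comap.const_mul_atTop two_pos).atTop_mul_const hz

lemma tendsto_robinF_zero {u : ℝ} (hu : 0 < u) :
    Tendsto (fun α : Ioi (0 : ℝ) ↦ robinF α u) (comap ((↑) : Ioi (0 : ℝ) → ℝ) (𝓝 0)) (𝓝 1) := by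
  refine tendsto_robinF (fun α ↦ α.2.le) hu fun z hz ↦ ?_
  have h : Continuous fun x : ℝ ↦ Real.exp (-(2 * x * z)) := by fun_prop
  simpa [Function.comp_def] using
    (h.tendsto 0).comp (tendsto_comap (f := ((↑) : Ioi (0 : ℝ) → ℝ)))

/-! ### Convergence of the variances -/

/-- The equality holds for `u ≤ 0` as well, where both sides vanish. -/
lemma one_div_sqrt_four_pi_mul (u : ℝ) :
    1 / √(4 * π * u) = (2 * √π)⁻¹ * u ^ (-(1 / 2) : ℝ) := by
  have h4 : √(4 * π) = 2 * √π := by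
    rw [Real.sqrt_mul (by norm_num), show (4 : ℝ) = 2 ^ 2 by norm_num,
      Real.sqrt_sq (by norm_num)]
  rw [Real.sqrt_mul (by positivity), h4, one_div, mul_inv]
  congr 1
  rcases le_or_gt 0 u with hu | hu
  · rw [Real.rpow_neg hu, Real.sqrt_eq_rpow]
  · rw [Real.sqrt_eq_zero_of_nonpos hu.le, Real.rpow_def_of_neg hu,
      show -(1 / 2) * π = -(π / 2) by ring, Real.cos_neg, Real.cos_pi_div_two]
    simp

lemma intervalIntegrable_one_div_sqrt (a b : ℝ) :
    IntervalIntegrable (fun u : ℝ ↦ 1 / √(4 * π * u)) volume a b := by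
  simp_rw [one_div_sqrt_four_pi_mul]
  exact (intervalIntegral.intervalIntegrable_rpow' (by norm_num)).const_mul _

lemma integral_one_div_sqrt (s : ℝ) :
    ∫ u in (0 : ℝ)..s, 1 / √(4 * π * u) = (√π)⁻¹ * s ^ (1 / 2 : ℝ) := by
  simp_rw [one_div_sqrt_four_pi_mul]
  rw [intervalIntegral.integral_const_mul, integral_rpow (.inl (by norm_num)),
    Real.zero_rpow (by norm_num), show (-(1 / 2) + 1 : ℝ) = 1 / 2 by norm_num, mul_inv]
  ring

lemma tendsto_iterated_integral_div_sqrt {ι : Type*} {l : Filter ι} [l.IsCountablyGenerated]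
    {φ : ι → ℝ → ℝ} {c : ℝ} (hm : ∀ i, Measurable (φ i)) (hb : ∀ i u, 0 < u → |φ i u| ≤ 1)
    (hφ : ∀ u, 0 < u → Tendsto (fun i ↦ φ i u) l (𝓝 c)) {t : ℝ} (ht : 0 ≤ t) :
    Tendsto (fun i ↦ ∫ s in (0 : ℝ)..t, ∫ r in (0 : ℝ)..s, φ i (s - r) / √(4 * π * (s - r))) l
      (𝓝 (c * (2 / 3 * ((√π)⁻¹ * t ^ (3 / 2 : ℝ))))) := by
  have hbound : ∀ i u, ‖φ i u / √(4 * π * u)‖ ≤ 1 / √(4 * π * u) := fun i u ↦ by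
    rcases le_or_gt u 0 with hu | hu
    · have : 4 * π * u ≤ 0 := mul_nonpos_of_nonneg_of_nonpos (by positivity) hu
      simp [Real.sqrt_eq_zero_of_nonpos this]
    · rw [norm_div, Real.norm_eq_abs, Real.norm_of_nonneg (Real.sqrt_nonneg _)]
      gcongr
      exact hb i u hu
  have hmeas : ∀ i, Measurable fun u ↦ φ i u / √(4 * π * u) := fun i ↦
    (hm i).div (by fun_prop)
  have hint : ∀ i a b, IntervalIntegrable (fun u ↦ φ i u / √(4 * π * u)) volume a b :=
    fun i a b ↦ (intervalIntegrable_one_div_sqrt a b).mono_fun'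
      (hmeas i).aestronglyMeasurable (.of_forall (hbound i))
  have hsubst : ∀ i s, ∫ r in (0 : ℝ)..s, φ i (s - r) / √(4 * π * (s - r)) =
      ∫ u in (0 : ℝ)..s, φ i u / √(4 * π * u) := fun i s ↦ by
    simpa using intervalIntegral.integral_comp_sub_left
      (a := 0) (b := s) (fun u ↦ φ i u / √(4 * π * u)) s
  have hlim : c * (2 / 3 * ((√π)⁻¹ * t ^ (3 / 2 : ℝ))) =
      ∫ s in (0 : ℝ)..t, c * ((√π)⁻¹ * s ^ (1 / 2 : ℝ)) := by
    rw [intervalIntegral.integral_const_mul, intervalIntegral.integral_const_mul,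
      integral_rpow (.inl (by norm_num)), Real.zero_rpow (by norm_num),
      show (1 / 2 + 1 : ℝ) = 3 / 2 by norm_num]
    ring
  simp_rw [hsubst]
  rw [hlim]
  refine intervalIntegral.tendsto_integral_filter_of_dominated_convergence
    (fun s ↦ (√π)⁻¹ * s ^ (1 / 2 : ℝ)) ?_ ?_ ?_ ?_
  · exact .of_forall fun i ↦
      (intervalIntegral.continuous_primitive (hint i) 0).aestronglyMeasurable
  · refine .of_forall fun i ↦ .of_forall fun s hs ↦ ?_
    rw [uIoc_of_le ht] at hs
    rw [← integral_one_div_sqrt]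
    exact intervalIntegral.norm_integral_le_of_norm_le hs.1.le
      (.of_forall fun u _ ↦ hbound i u) (intervalIntegrable_one_div_sqrt 0 s)
  · exact (intervalIntegral.intervalIntegrable_rpow' (by norm_num)).const_mul _
  · refine .of_forall fun s hs ↦ ?_
    rw [uIoc_of_le ht] at hs
    rw [← integral_one_div_sqrt, ← intervalIntegral.integral_const_mul]
    refine intervalIntegral.tendsto_integral_filter_of_dominated_convergence
      (fun u ↦ 1 / √(4 * π * u)) ?_ ?_ (intervalIntegrable_one_div_sqrt 0 s) ?_
    · exact .of_forall fun i ↦ (hmeas i).aestronglyMeasurable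
    · exact .of_forall fun i ↦ .of_forall fun u _ ↦ hbound i u
    · refine .of_forall fun u hu ↦ ?_
      rw [uIoc_of_le hs.1.le] at hu
      rw [mul_one_div]
      exact (hφ u hu.1).div_const _

lemma tendsto_varRobin (ρ : ℝ) {l : Filter (Ioi (0 : ℝ))} [l.IsCountablyGenerated] {c : ℝ}
    (h : ∀ u, 0 < u → Tendsto (fun α : Ioi (0 : ℝ) ↦ robinF α u) l (𝓝 c)) {t : ℝ} (ht : 0 ≤ t) :
    Tendsto (fun α : Ioi (0 : ℝ) ↦ varRobin ρ α t) l
      (𝓝 ((1 + c) * (4 / 3 * (chi ρ / √π) * t ^ (3 / 2 : ℝ)))) := by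
  have hlim := ((tendsto_iterated_integral_div_sqrt (fun α : Ioi (0 : ℝ) ↦ measurable_robinF α)
    (fun α u hu ↦ abs_robinF_le_one α.2.le hu) h ht).const_mul (2 * chi ρ)).const_add
      (4 / 3 * (chi ρ / √π) * t ^ (3 / 2 : ℝ))
  refine hlim.trans_eq (congrArg 𝓝 ?_)
  ring

lemma varRobin_zero (ρ α : ℝ) : varRobin ρ α 0 = 0 := by
  simp [varRobin, Real.zero_rpow]

end OccupationTime

end

theorem corollary5p4
    (ρ : ℝ) (hρ : ρ ∈ Icc (0 : ℝ) 1) (T : ℝ) (hT : 0 < T)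
    -- the processes `Γ_α`, `α > 0`, each on its own probability space
    {Ω : Ioi (0 : ℝ) → Type*} [∀ α, MeasurableSpace (Ω α)]
    (P : (α : Ioi (0 : ℝ)) → Measure (Ω α)) [∀ α, IsProbabilityMeasure (P α)]
    (Γ : (α : Ioi (0 : ℝ)) → Icc (0 : ℝ) T → Ω α → ℝ)
    (hΓ : ∀ α : Ioi (0 : ℝ),
      OccupationTime.IsStationaryGaussian (Γ α) (P α) (OccupationTime.varRobin ρ α))
    -- the process `Γ_∞`
    {Ωinf : Type*} [MeasurableSpace Ωinf] (Pinf : Measure Ωinf) [IsProbabilityMeasure Pinf]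
    (Γinf : Icc (0 : ℝ) T → Ωinf → ℝ)
    (hΓinf : OccupationTime.IsStationaryGaussian Γinf Pinf (OccupationTime.varInfty ρ))
    -- the process `Γ_0`
    {Ωzero : Type*} [MeasurableSpace Ωzero] (Pzero : Measure Ωzero) [IsProbabilityMeasure Pzero]
    (Γzero : Icc (0 : ℝ) T → Ωzero → ℝ)
    (hΓzero : OccupationTime.IsStationaryGaussian Γzero Pzero (OccupationTime.varZero ρ)) :
    -- `Γ_∞` and `Γ_0` are fractional Brownian motions, the second with twice the variance
    OccupationTime.IsFractionalBrownianMotion (3 / 4)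
        (4 / 3 * (OccupationTime.chi ρ / √π)) Γinf Pinf ∧
      OccupationTime.IsFractionalBrownianMotion (3 / 4)
        (2 * (4 / 3 * (OccupationTime.chi ρ / √π))) Γzero Pzero ∧
      -- `Γ_α → Γ_∞` as `α → ∞`
      OccupationTime.ConvergesFDD Γ P (comap ((↑) : Ioi (0 : ℝ) → ℝ) atTop) Γinf Pinf ∧
      -- `Γ_α → Γ_0` as `α → 0`
      OccupationTime.ConvergesFDD Γ P (comap ((↑) : Ioi (0 : ℝ) → ℝ) (𝓝 0)) Γzero Pzero := by
  have hinf0 : OccupationTime.varInfty ρ 0 = 0 := by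
    simp [OccupationTime.varInfty, Real.zero_rpow]
  have hzero0 : OccupationTime.varZero ρ 0 = 0 := by
    simp [OccupationTime.varZero, Real.zero_rpow]
  have hpow : (2 : ℝ) * (3 / 4) = 3 / 2 := by norm_num
  refine ⟨?_, ?_, ?_, ?_⟩
  · refine OccupationTime.IsStationaryGaussian.isFractionalBrownianMotion (by norm_num) ?_
    rw [hpow]
    exact hΓinf
  · refine OccupationTime.IsStationaryGaussian.isFractionalBrownianMotion (by norm_num) ?_
    rw [hpow]
    convert hΓzero using 2 with t
    rw [OccupationTime.varZero]
    ring
  · refine OccupationTime.IsStationaryGaussian.convergesFDD hΓ hΓinf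
      (fun α ↦ OccupationTime.varRobin_zero ρ α) hinf0 fun t ht ↦ ?_
    convert OccupationTime.tendsto_varRobin ρ
      (fun u hu ↦ OccupationTime.tendsto_robinF_atTop hu) ht using 2
    rw [OccupationTime.varInfty]
    ring
  · refine OccupationTime.IsStationaryGaussian.convergesFDD hΓ hΓzero
      (fun α ↦ OccupationTime.varRobin_zero ρ α) hzero0 fun t ht ↦ ?_
    convert OccupationTime.tendsto_varRobin ρ
      (fun u hu ↦ OccupationTime.tendsto_robinF_zero hu) ht using 2
    rw [OccupationTime.varZero]
    ring
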